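/- For a permutation $\sigma$ of $\{1,\dots,n\}$, let $L(\sigma)$ be the length of a longest increasing subsequence of $\sigma$, i.e. the largest $k$ for which there are indices $1\le i_1<\dots<i_k\le n$ with $\sigma(i_1)<\dots<\sigma(i_k)$. Let $$\ell_n=\mathbb{E}[L(\sigma_n)]=\frac1{n!}\sum_{\sigma\in S_n}L(\sigma)$$ be the expected value of $L$ for a uniformly random permutation $\sigma_n\in S_n$. Then $$\frac{\pi}{2}\;\le\;\liminf_{n\to\infty}\frac{\ell_n}{\sqrt n}\;\le\;\limsup_{n\to\infty}\frac{\ell_n}{\sqrt n}\;\le\; e .$$ -/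

import Mathlib

/-- `L(σ)`: the maximal length of an increasing subsequence of `σ(0), …, σ(n-1)`. A subsequence is
given by its set `s` of positions, and its length is the number of these positions. -/
def lisLength {n : ℕ} (σ : Equiv.Perm (Fin n)) : ℕ :=
  (Finset.univ.filter fun s : Finset (Fin n) =>
    ∀ i ∈ s, ∀ j ∈ s, i < j → σ i < σ j).sup Finset.card

/-- `ℓ_n`: the mean of `L(σ)` over a uniformly random permutation `σ` of `n` elements. -/
noncomputable def expectedLIS (n : ℕ) : ℝ :=
  (1 / (n.factorial : ℝ)) * ∑ σ : Equiv.Perm (Fin n), (lisLength σ : ℝ)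

/-! The upper bound is a first moment estimate. A given set of `k` positions is increasing for at
most a fraction `1 / k!` of the permutations, so `L ≥ k` has probability at most `n ^ k / k! ^ 2`.
For `k ≥ a √n` this is at most `(e / a) ^ (2 * k)`, which beats the trivial bound `L ≤ n` once `a >
e` (`exists_expectedLIS_le`).

The lower bound analyses a greedy chain. Let each cell of a `K × K` grid be occupied independently
with probability `1 - exp (-l)`. From a corner, scan successive antidiagonals of its quadrant until
an occupied cell appears, take it, and restart from the corner strictly beyond it. Averaging over
the two scanning directions makes the two coordinates advance equally, by a mean of at most `1 + √(π
/ (2 l)) / 2`. An exponential moment bound shows that a chain of nearly `K` divided by this mean is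
missing only with exponentially small probability (`bernSum_noChain_le`). With `l K² ≈ n` and `l`
small the chain has about `√(8 / π) √n` cells. Since `√(8 / π) > π / 2`, there is room for all
discretization losses.

Independent cells become `n` uniform points by Poissonization (`pointAvg_mul_le_bernSum`). Points
become a uniform permutation by permuting second coordinates
(`mul_one_sub_pointAvg_le_expectedLIS`). -/

/-! ### Random subsets with independent elements -/

/-- Expectation of `F T`, where the random subset `T` of `U` misses each element independently with
probability `q`. -/
noncomputable def bernSum {α : Type*} (q : ℝ) (U : Finset α) (F : Finset α → ℝ) : ℝ :=
  ∑ T ∈ U.powerset, (1 - q) ^ T.card * q ^ (U.card - T.card) * F T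

lemma bernSum_empty {α : Type*} (q : ℝ) (F : Finset α → ℝ) : bernSum q ∅ F = F ∅ := by
  simp [bernSum]

lemma bernSum_insert {α : Type*} [DecidableEq α] (q : ℝ) {U : Finset α} {c : α} (hc : c ∉ U)
    (F : Finset α → ℝ) :
    bernSum q (insert c U) F =
      (1 - q) * bernSum q U (fun T => F (insert c T)) + q * bernSum q U F := by
  unfold bernSum
  rw [Finset.sum_powerset_insert hc, add_comm, Finset.mul_sum, Finset.mul_sum]
  congr 1
  · refine Finset.sum_congr rfl fun T hT => ?_
    have hcT : c ∉ T := fun h => hc (Finset.mem_powerset.1 hT h)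
    rw [Finset.card_insert_of_notMem hc, Finset.card_insert_of_notMem hcT,
      Nat.add_sub_add_right]
    ring
  · refine Finset.sum_congr rfl fun T hT => ?_
    have hle := Finset.card_le_card (Finset.mem_powerset.1 hT)
    rw [Finset.card_insert_of_notMem hc, Nat.sub_add_comm hle]
    ring

lemma bernSum_mono {α : Type*} {q : ℝ} (h0 : 0 ≤ q) (h1 : q ≤ 1) (U : Finset α)
    {F G : Finset α → ℝ} (h : ∀ T ⊆ U, F T ≤ G T) : bernSum q U F ≤ bernSum q U G := by
  refine Finset.sum_le_sum fun T hT => mul_le_mul_of_nonneg_left (h T (Finset.mem_powerset.1 hT)) ?_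
  have : 0 ≤ 1 - q := by linarith
  positivity

lemma bernSum_const {α : Type*} (q : ℝ) (U : Finset α) (a : ℝ) :
    bernSum q U (fun _ => a) = a := by
  classical
  induction U using Finset.induction_on with
  | empty => simp [bernSum_empty]
  | insert c U hc ih => rw [bernSum_insert q hc, ih]; ring

/-- An element failing `P` does not affect the integrand, and its two weights `1 - q` and `q` add up
to `1`. -/
lemma bernSum_filter {α : Type*} [DecidableEq α] (q : ℝ) (P : α → Prop) [DecidablePred P]
    (U : Finset α) (F : Finset α → ℝ) :
    bernSum q U (fun T => F (T.filter P)) = bernSum q (U.filter P) F := by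
  induction U using Finset.induction_on generalizing F with
  | empty => simp [bernSum_empty]
  | insert c U hc ih =>
    rw [bernSum_insert q hc, Finset.filter_insert]
    by_cases hP : P c
    · simp only [Finset.filter_insert, hP, if_true]
      rw [bernSum_insert q (by simp [hc]), ih F, ih fun T => F (insert c T)]
    · simp only [Finset.filter_insert, hP, if_false]
      rw [ih F]; ring

lemma bernSum_anti {α : Type*} [DecidableEq α] {q : ℝ} (h0 : 0 ≤ q) (h1 : q ≤ 1)
    {F : Finset α → ℝ} (hF : Antitone F) {U V : Finset α} (h : U ⊆ V) :
    bernSum q V F ≤ bernSum q U F := by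
  have hU : V.filter (· ∈ U) = U := by
    ext x; simpa using fun hx => h hx
  conv_rhs => rw [← hU, ← bernSum_filter]
  exact bernSum_mono h0 h1 V fun T _ => hF (Finset.filter_subset _ _)

/-! ### Chains of cells and sequential inspection -/

/-- `T` contains `k` cells that are pairwise strictly comparable in both coordinates. -/
def HasChain (k : ℕ) (T : Finset (ℕ × ℕ)) : Prop :=
  ∃ s ⊆ T, s.card = k ∧ ∀ a ∈ s, ∀ b ∈ s, a ≠ b →
    (a.1 < b.1 ∧ a.2 < b.2) ∨ (b.1 < a.1 ∧ b.2 < a.2)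

open Classical in
/-- The indicator of the absence of a chain of `k` cells. -/
noncomputable def noChain (k : ℕ) (T : Finset (ℕ × ℕ)) : ℝ := if HasChain k T then 0 else 1

lemma HasChain.mono {k : ℕ} {S T : Finset (ℕ × ℕ)} (h : HasChain k S) (hST : S ⊆ T) :
    HasChain k T := by
  obtain ⟨s, hs, h⟩ := h
  exact ⟨s, hs.trans hST, h⟩

lemma hasChain_zero (T : Finset (ℕ × ℕ)) : HasChain 0 T := ⟨∅, by simp⟩

lemma noChain_nonneg (k : ℕ) (T : Finset (ℕ × ℕ)) : 0 ≤ noChain k T := by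
  unfold noChain; split_ifs <;> norm_num

lemma noChain_le_one (k : ℕ) (T : Finset (ℕ × ℕ)) : noChain k T ≤ 1 := by
  unfold noChain; split_ifs <;> norm_num

lemma noChain_le_of_imp {k l : ℕ} {S T : Finset (ℕ × ℕ)} (h : HasChain k S → HasChain l T) :
    noChain l T ≤ noChain k S := by
  unfold noChain
  split_ifs with h₁ h₂ h₂
  · exact le_rfl
  · norm_num
  · exact absurd (h h₂) h₁
  · exact le_rfl

lemma noChain_antitone (k : ℕ) : Antitone (noChain k) := fun _ _ hST =>
  noChain_le_of_imp fun h => h.mono hST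

lemma HasChain.insert_below {k : ℕ} {T : Finset (ℕ × ℕ)} {c : ℕ × ℕ}
    (h : HasChain k (T.filter fun d => c.1 < d.1 ∧ c.2 < d.2)) :
    HasChain (k + 1) (insert c T) := by
  obtain ⟨s, hs, hk, hs'⟩ := h
  have hs2 : ∀ d ∈ s, c.1 < d.1 ∧ c.2 < d.2 := fun d hd => (Finset.mem_filter.1 (hs hd)).2
  have hc : c ∉ s := fun h => absurd (hs2 c h).1 (lt_irrefl _)
  refine ⟨insert c s, Finset.insert_subset_insert c (hs.trans (Finset.filter_subset _ _)),
    by rw [Finset.card_insert_of_notMem hc, hk], ?_⟩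
  intro a ha b hb hab
  rcases Finset.mem_insert.1 ha with ha | ha <;> rcases Finset.mem_insert.1 hb with hb | hb
  · exact absurd (ha.trans hb.symm) hab
  · exact Or.inl (ha ▸ hs2 b hb)
  · exact Or.inr (hb ▸ hs2 a ha)
  · exact hs' a ha b hb hab

lemma bernSum_noChain_le_one {q : ℝ} (h0 : 0 ≤ q) (h1 : q ≤ 1) (k : ℕ) (U : Finset (ℕ × ℕ)) :
    bernSum q U (noChain k) ≤ 1 := by
  have := bernSum_mono h0 h1 U (G := fun _ => 1) fun T _ => noChain_le_one k T
  rwa [bernSum_const] at this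

/-- Inspecting one cell `c`: either it is occupied, and may serve as the start of a chain, or it can
be discarded. -/
lemma bernSum_noChain_inspect {q : ℝ} (h0 : 0 ≤ q) (h1 : q ≤ 1) (k : ℕ) {V : Finset (ℕ × ℕ)}
    {c : ℕ × ℕ} (hc : c ∈ V) :
    bernSum q V (noChain (k + 1)) ≤
      (1 - q) * bernSum q (V.filter fun d => c.1 < d.1 ∧ c.2 < d.2) (noChain k) +
        q * bernSum q (V.erase c) (noChain (k + 1)) := by
  have hV : V.filter (fun d => c.1 < d.1 ∧ c.2 < d.2) =
      (V.erase c).filter (fun d => c.1 < d.1 ∧ c.2 < d.2) := by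
    ext d
    simp only [Finset.mem_filter, Finset.mem_erase]
    refine ⟨fun h => ⟨⟨?_, h.1⟩, h.2⟩, fun h => ⟨h.1.2, h.2⟩⟩
    rintro rfl
    exact lt_irrefl _ h.2.1
  rw [hV, ← bernSum_filter]
  conv_lhs => rw [← Finset.insert_erase hc]
  rw [bernSum_insert q (Finset.notMem_erase c V)]
  gcongr
  exact bernSum_mono h0 h1 _ fun T _ => noChain_le_of_imp HasChain.insert_below

/-- Inspecting an antichain of cells one after the other. -/
lemma bernSum_noChain_inspect_seq {q : ℝ} (h0 : 0 ≤ q) (h1 : q ≤ 1) (k : ℕ) (V : Finset (ℕ × ℕ))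
    (c : ℕ → ℕ × ℕ) (B : ℕ → ℝ) (m : ℕ)
    (hinj : Set.InjOn c (Set.Iio m))
    (hanti : ∀ t < m, ∀ u < m, ¬ ((c t).1 < (c u).1 ∧ (c t).2 < (c u).2))
    (hin : ∀ t < m, c t ∈ V →
      bernSum q (V.filter fun d => (c t).1 < d.1 ∧ (c t).2 < d.2) (noChain k) ≤ B t)
    (hout : ∀ t < m, c t ∉ V → 1 ≤ B t) :
    bernSum q V (noChain (k + 1)) ≤ ∑ t ∈ Finset.range m, (1 - q) * q ^ t * B t +
      q ^ m * bernSum q (V \ (Finset.range m).image c) (noChain (k + 1)) := by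
  induction m with
  | zero => simp
  | succ m ih =>
    have ih' := ih (hinj.mono fun x (hx : x < m) => Nat.lt_succ_of_lt hx)
      (fun t ht u hu => hanti t (Nat.lt_succ_of_lt ht) u (Nat.lt_succ_of_lt hu))
      (fun t ht => hin t (Nat.lt_succ_of_lt ht)) (fun t ht => hout t (Nat.lt_succ_of_lt ht))
    refine ih'.trans ?_
    set W := V \ (Finset.range m).image c with hW
    have hW' : V \ (Finset.range (m + 1)).image c = W.erase (c m) := by
      rw [Finset.range_add_one, Finset.image_insert, hW]
      ext d; simp only [Finset.mem_sdiff, Finset.mem_insert, Finset.mem_erase]; tauto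
    have hp : 0 ≤ 1 - q := by linarith
    have key : bernSum q W (noChain (k + 1)) ≤
        (1 - q) * B m + q * bernSum q (W.erase (c m)) (noChain (k + 1)) := by
      by_cases hm : c m ∈ V
      · have hmW : c m ∈ W := by
          rw [hW, Finset.mem_sdiff]
          refine ⟨hm, fun h => ?_⟩
          obtain ⟨t, ht, hct⟩ := Finset.mem_image.1 h
          have ht := Finset.mem_range.1 ht
          exact ht.ne (hinj (Nat.lt_succ_of_lt ht) (Nat.lt_succ_self m) hct)
        refine (bernSum_noChain_inspect h0 h1 k hmW).trans ?_
        have hf : W.filter (fun d => (c m).1 < d.1 ∧ (c m).2 < d.2) =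
            V.filter (fun d => (c m).1 < d.1 ∧ (c m).2 < d.2) := by
          ext d
          simp only [hW, Finset.mem_filter, Finset.mem_sdiff, Finset.mem_image, Finset.mem_range]
          refine ⟨fun h => ⟨h.1.1, h.2⟩, fun h => ⟨⟨h.1, ?_⟩, h.2⟩⟩
          rintro ⟨t, ht, rfl⟩
          exact hanti m (Nat.lt_succ_self m) t (Nat.lt_succ_of_lt ht) h.2
        rw [hf]
        gcongr
        exact hin m (Nat.lt_succ_self m) hm
      -- There is nothing to inspect outside `V`; since the probability is at most `1 ≤ B m`, mixing
      -- in `B m` only weakens the bound.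
      · have hmW : c m ∉ W := fun h => hm (Finset.mem_sdiff.1 h).1
        rw [Finset.erase_eq_of_notMem hmW]
        have hB := hout m (Nat.lt_succ_self m) hm
        have hg := bernSum_noChain_le_one h0 h1 (k + 1) W
        nlinarith
    rw [hW', Finset.sum_range_succ]
    have := mul_le_mul_of_nonneg_left key (pow_nonneg h0 m)
    rw [pow_succ]
    linarith

/-! ### The greedy search along antidiagonals -/

/-- The cells of the `K × K` box in the quadrant with corner `(i, j)`, on or beyond its `s`-th
antidiagonal. -/
def cornerBox (K i j s : ℕ) : Finset (ℕ × ℕ) :=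
  (Finset.range K ×ˢ Finset.range K).filter fun d => i ≤ d.1 ∧ j ≤ d.2 ∧ i + j + s ≤ d.1 + d.2

lemma mem_cornerBox {K i j s : ℕ} {d : ℕ × ℕ} :
    d ∈ cornerBox K i j s ↔ (d.1 < K ∧ d.2 < K) ∧ i ≤ d.1 ∧ j ≤ d.2 ∧ i + j + s ≤ d.1 + d.2 := by
  simp [cornerBox]

/-- Contribution of the `s`-th antidiagonal to the exponential moment of one greedy step. -/
noncomputable def diagMoment (q η : ℝ) (s : ℕ) : ℝ :=
  ∑ x ∈ Finset.range (s + 1), (1 - q) * ((q ^ x + q ^ (s - x)) / 2) * Real.exp (η * (x + 1))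

lemma diagMoment_reflect (q η : ℝ) (s : ℕ) :
    diagMoment q η s = ∑ x ∈ Finset.range (s + 1),
      (1 - q) * ((q ^ x + q ^ (s - x)) / 2) * Real.exp (η * (((s - x : ℕ) : ℝ) + 1)) := by
  unfold diagMoment
  rw [← Finset.sum_range_reflect]
  refine Finset.sum_congr rfl fun x hx => ?_
  have hx := Finset.mem_range.1 hx
  have h1 : s + 1 - 1 - x = s - x := by omega
  have h2 : s - (s - x) = x := by omega
  rw [h1, h2]
  ring

/-- Potential bounding the failure probability from the corner `(i, j)`. -/
noncomputable def cornerPotential (η : ℝ) (K i j : ℕ) : ℝ :=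
  Real.exp (η * (i - K)) + Real.exp (η * (j - K))

lemma cornerPotential_pos (η : ℝ) (K i j : ℕ) : 0 < cornerPotential η K i j := by
  unfold cornerPotential; positivity

/-- A corner outside the box admits no further cell, so the potential must dominate the trivial
probability bound `1` there. -/
lemma one_le_cornerPotential {η : ℝ} (hη : 0 ≤ η) {K i j : ℕ} (h : K ≤ i ∨ K ≤ j) :
    1 ≤ cornerPotential η K i j := by
  unfold cornerPotential
  rcases h with h | h
  · have h' : (K : ℝ) ≤ i := by exact_mod_cast h
    have := Real.one_le_exp (mul_nonneg hη (sub_nonneg.2 h'))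
    linarith [Real.exp_pos (η * ((j : ℝ) - K))]
  · have h' : (K : ℝ) ≤ j := by exact_mod_cast h
    have := Real.one_le_exp (mul_nonneg hη (sub_nonneg.2 h'))
    linarith [Real.exp_pos (η * ((i : ℝ) - K))]

/-- The averaged weights are invariant under `x ↦ s - x`, so both exponentials pick up the same
factor and the potential is an eigenfunction of the step. -/
lemma sum_cornerPotential (q η : ℝ) (K i j s : ℕ) :
    ∑ x ∈ Finset.range (s + 1), (1 - q) * ((q ^ x + q ^ (s - x)) / 2) *
        cornerPotential η K (i + x + 1) (j + (s - x) + 1) =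
      diagMoment q η s * cornerPotential η K i j := by
  unfold cornerPotential
  rw [mul_add]
  conv_rhs => arg 2; rw [diagMoment_reflect]
  rw [diagMoment, Finset.sum_mul, Finset.sum_mul, ← Finset.sum_add_distrib]
  refine Finset.sum_congr rfl fun x _ => ?_
  have e1 : Real.exp (η * (((i + x + 1 : ℕ) : ℝ) - K)) =
      Real.exp (η * (x + 1)) * Real.exp (η * (i - K)) := by
    rw [← Real.exp_add]; congr 1; push_cast; ring
  have e2 : Real.exp (η * (((j + (s - x) + 1 : ℕ) : ℝ) - K)) =
      Real.exp (η * (((s - x : ℕ) : ℝ) + 1)) * Real.exp (η * (j - K)) := by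
    rw [← Real.exp_add]; congr 1; push_cast; ring
  rw [e1, e2]
  ring

/-- One antidiagonal of the greedy search. -/
lemma bernSum_noChain_antidiagonal {q : ℝ} (h0 : 0 ≤ q) (h1 : q ≤ 1) {η : ℝ} (hη : 0 ≤ η)
    (K k i j s : ℕ) {M : ℝ} (hM : 1 ≤ M)
    (ih : ∀ i j, bernSum q (cornerBox K i j 0) (noChain k) ≤ M * cornerPotential η K i j) :
    bernSum q (cornerBox K i j s) (noChain (k + 1)) ≤
      M * (diagMoment q η s * cornerPotential η K i j) +
        q ^ (s + 1) * bernSum q (cornerBox K i j (s + 1)) (noChain (k + 1)) := by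
  set V := cornerBox K i j s
  set B : ℕ → ℝ := fun x => M * cornerPotential η K (i + x + 1) (j + (s - x) + 1)
  set g := bernSum q (cornerBox K i j (s + 1)) (noChain (k + 1))
  have hin : ∀ x ≤ s, (i + x, j + (s - x)) ∈ V →
      bernSum q (V.filter fun d => i + x < d.1 ∧ j + (s - x) < d.2) (noChain k) ≤ B x := by
    intro x hx _
    refine (bernSum_anti h0 h1 (noChain_antitone k) ?_).trans (ih (i + x + 1) (j + (s - x) + 1))
    intro d hd
    rw [mem_cornerBox] at hd
    rw [Finset.mem_filter, mem_cornerBox]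
    omega
  have hout : ∀ x ≤ s, (i + x, j + (s - x)) ∉ V → 1 ≤ B x := by
    intro x hx hd
    rw [mem_cornerBox] at hd
    have := one_le_cornerPotential hη (K := K) (i := i + x + 1) (j := j + (s - x) + 1)
      (by simp only at hd; omega)
    exact one_le_mul_of_one_le_of_one_le hM this
  have hrest : ∀ c : ℕ → ℕ × ℕ, (∀ t < s + 1, (c t).1 + (c t).2 = i + j + s) →
      bernSum q (V \ (Finset.range (s + 1)).image c) (noChain (k + 1)) ≤ g := by
    intro c hc
    refine bernSum_anti h0 h1 (noChain_antitone _) fun d hd => ?_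
    rw [mem_cornerBox] at hd
    rw [Finset.mem_sdiff, mem_cornerBox]
    refine ⟨by omega, fun h => ?_⟩
    obtain ⟨t, ht, rfl⟩ := Finset.mem_image.1 h
    have := hc t (Finset.mem_range.1 ht)
    omega
  have hq : 0 ≤ q ^ (s + 1) := pow_nonneg h0 _
  have up : bernSum q V (noChain (k + 1)) ≤
      ∑ x ∈ Finset.range (s + 1), (1 - q) * q ^ x * B x + q ^ (s + 1) * g := by
    refine (bernSum_noChain_inspect_seq h0 h1 k V (fun x => (i + x, j + (s - x))) B (s + 1)
      ?_ ?_ ?_ ?_).trans ?_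
    · intro x _ y _ hxy
      simp only [Prod.mk.injEq] at hxy
      omega
    · intro t ht u hu
      simp only
      omega
    · exact fun t ht => hin t (by omega)
    · exact fun t ht => hout t (by omega)
    · gcongr
      exact hrest _ fun t ht => by simp only; omega
  have down : bernSum q V (noChain (k + 1)) ≤
      ∑ x ∈ Finset.range (s + 1), (1 - q) * q ^ (s - x) * B x + q ^ (s + 1) * g := by
    rw [← Finset.sum_range_reflect]
    have hsub : ∀ x < s + 1, s + 1 - 1 - x = s - x ∧ s - (s - x) = x := by omega
    refine (bernSum_noChain_inspect_seq h0 h1 k V (fun x => (i + (s - x), j + (s - (s - x))))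
      (fun x => B (s - x)) (s + 1) ?_ ?_ ?_ ?_).trans ?_
    · intro x hx y hy hxy
      simp only [Prod.mk.injEq] at hxy
      simp only [Set.mem_Iio] at hx hy
      omega
    · intro t ht u hu
      simp only
      omega
    · exact fun t ht => hin (s - t) (by omega)
    · exact fun t ht => hout (s - t) (by omega)
    · refine add_le_add (le_of_eq (Finset.sum_congr rfl fun x hx => ?_)) ?_
      · obtain ⟨e1, e2⟩ := hsub x (Finset.mem_range.1 hx)
        rw [e1, e2]
      · gcongr
        exact hrest _ fun t ht => by simp only; omega
  -- Both scanning orders bound the same probability, hence so does their mean; the search itself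
  -- needs no random direction.
  have avg : M * (diagMoment q η s * cornerPotential η K i j) =
      (∑ x ∈ Finset.range (s + 1), (1 - q) * q ^ x * B x +
        ∑ x ∈ Finset.range (s + 1), (1 - q) * q ^ (s - x) * B x) / 2 := by
    rw [← sum_cornerPotential, Finset.mul_sum, ← Finset.sum_add_distrib, Finset.sum_div]
    refine Finset.sum_congr rfl fun x _ => ?_
    simp only [B]
    ring
  rw [avg]
  linarith

/-- The probability that the first `s` antidiagonals are empty. -/
noncomputable def emptyProb (q : ℝ) (s : ℕ) : ℝ := ∏ t ∈ Finset.range s, q ^ (t + 1)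

lemma emptyProb_succ (q : ℝ) (s : ℕ) : emptyProb q (s + 1) = emptyProb q s * q ^ (s + 1) :=
  Finset.prod_range_succ _ _

lemma emptyProb_nonneg {q : ℝ} (h0 : 0 ≤ q) (s : ℕ) : 0 ≤ emptyProb q s :=
  Finset.prod_nonneg fun _ _ => pow_nonneg h0 _

lemma emptyProb_le_pow {q : ℝ} (h0 : 0 ≤ q) (h1 : q ≤ 1) (s : ℕ) : emptyProb q s ≤ q ^ s := by
  induction s with
  | zero => simp [emptyProb]
  | succ s ih =>
    rw [emptyProb_succ]
    calc emptyProb q s * q ^ (s + 1) ≤ q ^ s * q :=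
          mul_le_mul ih (pow_le_of_le_one h0 h1 (by omega)) (pow_nonneg h0 _) (pow_nonneg h0 _)
      _ = q ^ (s + 1) := (pow_succ q s).symm

/-- If `θ` bounds the exponential moment of a greedy step, then a chain of length `k` is missing from
the box with probability at most `θ ^ k` times the potential. -/
lemma bernSum_noChain_le {q : ℝ} (h0 : 0 ≤ q) (h1 : q < 1) {η : ℝ} (hη : 0 ≤ η) {θ : ℝ}
    (hθ : 1 ≤ θ)
    (hsum : ∀ S, ∑ s ∈ Finset.range S, emptyProb q s * diagMoment q η s ≤ θ) (K k : ℕ) :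
    ∀ i j, bernSum q (cornerBox K i j 0) (noChain k) ≤ θ ^ k * cornerPotential η K i j := by
  induction k with
  | zero =>
    intro i j
    have : bernSum q (cornerBox K i j 0) (noChain 0) = 0 := by
      have : noChain 0 = fun _ => 0 := by
        funext T; simp [noChain, hasChain_zero]
      rw [this, bernSum_const]
    rw [this, pow_zero, one_mul]
    exact (cornerPotential_pos η K i j).le
  | succ k ih =>
    intro i j
    have hMk : 1 ≤ θ ^ k := one_le_pow₀ hθ
    set E := cornerPotential η K i j
    have hE : 0 < E := cornerPotential_pos η K i j
    have step : ∀ S, bernSum q (cornerBox K i j 0) (noChain (k + 1)) ≤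
        θ ^ k * ((∑ s ∈ Finset.range S, emptyProb q s * diagMoment q η s) * E) +
          emptyProb q S * bernSum q (cornerBox K i j S) (noChain (k + 1)) := by
      intro S
      induction S with
      | zero => simp [emptyProb]
      | succ S ihS =>
        refine ihS.trans ?_
        have := mul_le_mul_of_nonneg_left
          (bernSum_noChain_antidiagonal h0 h1.le hη K k i j S hMk ih) (emptyProb_nonneg h0 S)
        rw [Finset.sum_range_succ, emptyProb_succ]
        linarith
    -- Stopping the search after `S` antidiagonals leaves an error of at most `q ^ S`, which
    -- disappears in the limit.
    have bound : ∀ S : ℕ, bernSum q (cornerBox K i j 0) (noChain (k + 1)) ≤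
        θ ^ (k + 1) * E + q ^ S := by
      intro S
      refine (step S).trans (add_le_add ?_ ?_)
      · rw [pow_succ, mul_assoc]
        have := hsum S
        gcongr
      · calc _ ≤ emptyProb q S * 1 := mul_le_mul_of_nonneg_left
              (bernSum_noChain_le_one h0 h1.le _ _) (emptyProb_nonneg h0 S)
          _ ≤ _ := by rw [mul_one]; exact emptyProb_le_pow h0 h1.le S
    have lim : Filter.Tendsto (fun S : ℕ => θ ^ (k + 1) * E + q ^ S) Filter.atTop
        (nhds (θ ^ (k + 1) * E + 0)) :=
      (tendsto_pow_atTop_nhds_zero_of_lt_one h0 h1).const_add _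
    rw [add_zero] at lim
    exact ge_of_tendsto' lim bound

/-! ### The exponential moment of one greedy step -/

lemma sum_diagWeights (q : ℝ) (s : ℕ) :
    ∑ x ∈ Finset.range (s + 1), (1 - q) * ((q ^ x + q ^ (s - x)) / 2) = 1 - q ^ (s + 1) := by
  have hr : ∑ x ∈ Finset.range (s + 1), q ^ (s - x) = ∑ x ∈ Finset.range (s + 1), q ^ x := by
    rw [← Finset.sum_range_reflect (fun x => q ^ x)]
    rfl
  rw [← Finset.mul_sum, ← Finset.sum_div, Finset.sum_add_distrib, hr]
  have := mul_neg_geom_sum q (s + 1)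
  linarith

/-- By the symmetry `x ↦ s - x`, the mean of `x + 1` under the weights is the midpoint `(s + 2) /
2`. -/
lemma sum_diagWeights_mul (q : ℝ) (s : ℕ) :
    ∑ x ∈ Finset.range (s + 1), (1 - q) * ((q ^ x + q ^ (s - x)) / 2) * ((x : ℝ) + 1) =
      (1 - q ^ (s + 1)) * ((s + 2) / 2) := by
  have hr : ∑ x ∈ Finset.range (s + 1), (1 - q) * ((q ^ x + q ^ (s - x)) / 2) * ((x : ℝ) + 1) =
      ∑ x ∈ Finset.range (s + 1), (1 - q) * ((q ^ x + q ^ (s - x)) / 2) * ((s : ℝ) - x + 1) := by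
    rw [← Finset.sum_range_reflect]
    refine Finset.sum_congr rfl fun x hx => ?_
    have hx := Finset.mem_range.1 hx
    have h1 : s + 1 - 1 - x = s - x := by omega
    have h2 : s - (s - x) = x := by omega
    rw [h1, h2, Nat.cast_sub (by omega)]
    ring
  have hadd := congrArg₂ (· + ·) hr hr
  have h2 : ∑ x ∈ Finset.range (s + 1), (1 - q) * ((q ^ x + q ^ (s - x)) / 2) * ((x : ℝ) + 1) +
      ∑ x ∈ Finset.range (s + 1), (1 - q) * ((q ^ x + q ^ (s - x)) / 2) * ((s : ℝ) - x + 1) =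
      (1 - q ^ (s + 1)) * (s + 2) := by
    rw [← Finset.sum_add_distrib, ← sum_diagWeights, Finset.sum_mul]
    refine Finset.sum_congr rfl fun x _ => ?_
    ring
  linarith

/-- Apply `exp z ≤ 1 + z * exp z` twice, the second time inside its own right-hand side. -/
lemma exp_le_one_add_add_sq_mul_exp {z : ℝ} (hz : 0 ≤ z) :
    Real.exp z ≤ 1 + z + z ^ 2 * Real.exp z := by
  have h1 : Real.exp z - 1 ≤ z * Real.exp z := by
    have := Real.add_one_le_exp (-z)
    have h2 : Real.exp (-z) * Real.exp z = 1 := by rw [← Real.exp_add]; simp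
    nlinarith [Real.exp_pos z]
  nlinarith [Real.exp_pos z]

lemma diagMoment_le {q : ℝ} (h0 : 0 ≤ q) (h1 : q ≤ 1) {η : ℝ} (hη : 0 ≤ η) (hη1 : η ≤ 1) (s : ℕ) :
    diagMoment q η s ≤ (1 - q ^ (s + 1)) *
      (1 + η * ((s + 2) / 2) + η ^ 2 * (((s : ℝ) + 1) ^ 2 * Real.exp (s + 1))) := by
  have hp : 0 ≤ 1 - q := by linarith
  have hterm : ∀ x ∈ Finset.range (s + 1),
      (1 - q) * ((q ^ x + q ^ (s - x)) / 2) * Real.exp (η * (x + 1)) ≤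
      (1 - q) * ((q ^ x + q ^ (s - x)) / 2) *
          (1 + η ^ 2 * (((s : ℝ) + 1) ^ 2 * Real.exp (s + 1))) +
        η * ((1 - q) * ((q ^ x + q ^ (s - x)) / 2) * ((x : ℝ) + 1)) := by
    intro x hx
    have hxs : (x : ℝ) ≤ s := by
      have := Finset.mem_range.1 hx
      exact_mod_cast Nat.lt_succ_iff.1 this
    have hx0 : (0 : ℝ) ≤ x := Nat.cast_nonneg x
    have hz : 0 ≤ η * ((x : ℝ) + 1) := by positivity
    have he : Real.exp (η * ((x : ℝ) + 1)) ≤ Real.exp (s + 1) :=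
      Real.exp_le_exp.2 (by nlinarith)
    have hsq : (η * ((x : ℝ) + 1)) ^ 2 * Real.exp (η * ((x : ℝ) + 1)) ≤
        η ^ 2 * (((s : ℝ) + 1) ^ 2 * Real.exp (s + 1)) := by
      rw [mul_pow, mul_assoc]
      gcongr
    have hexp := exp_le_one_add_add_sq_mul_exp hz
    have hw : 0 ≤ (1 - q) * ((q ^ x + q ^ (s - x)) / 2) := by positivity
    have := mul_le_mul_of_nonneg_left (hexp.trans (add_le_add_right hsq _)) hw
    linarith
  refine (Finset.sum_le_sum hterm).trans (le_of_eq ?_)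
  rw [Finset.sum_add_distrib, ← Finset.sum_mul, sum_diagWeights, ← Finset.mul_sum,
    sum_diagWeights_mul]
  ring

lemma sum_emptyProb_telescope (q : ℝ) (S : ℕ) :
    ∑ s ∈ Finset.range S, emptyProb q s * (1 - q ^ (s + 1)) = 1 - emptyProb q S := by
  induction S with
  | zero => simp [emptyProb]
  | succ S ih => rw [Finset.sum_range_succ, ih, emptyProb_succ]; ring

/-- Summation by parts: `emptyProb q s * (1 - q ^ (s + 1))` is the probability that the search stops
at level `s`. The subtracted boundary term can be dropped in upper bounds. -/
lemma sum_emptyProb_mean (q : ℝ) (S : ℕ) :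
    ∑ s ∈ Finset.range S, emptyProb q s * (1 - q ^ (s + 1)) * (((s : ℝ) + 2) / 2) =
      1 + (∑ s ∈ Finset.range S, emptyProb q (s + 1)) / 2
        - (S + 2) / 2 * emptyProb q S := by
  induction S with
  | zero => simp [emptyProb]
  | succ S ih =>
    rw [Finset.sum_range_succ, Finset.sum_range_succ, ih, emptyProb_succ]
    push_cast
    ring

lemma emptyProb_exp (l : ℝ) (s : ℕ) :
    emptyProb (Real.exp (-l)) s = Real.exp (-l * (s * (s + 1) / 2)) := by
  induction s with
  | zero => simp [emptyProb]
  | succ s ih =>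
    rw [emptyProb_succ, ih, ← Real.exp_nat_mul, ← Real.exp_add]
    congr 1
    push_cast
    ring

/-- The exponent satisfies `(s + 1) * (s + 2) / 2 ≥ (s + 1) ^ 2 / 2`, so the sum is at most a
right-endpoint Riemann sum of a decreasing Gaussian, hence at most its half-line integral. -/
lemma sum_emptyProb_le {l : ℝ} (hl : 0 < l) (S : ℕ) :
    ∑ s ∈ Finset.range S, emptyProb (Real.exp (-l)) (s + 1) ≤ √(Real.pi / (2 * l)) := by
  have hanti : AntitoneOn (fun x : ℝ => Real.exp (-(l / 2) * x ^ 2)) (Set.Icc (0 : ℝ) (0 + S)) := by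
    intro x hx y hy hxy
    have : x ^ 2 ≤ y ^ 2 := pow_le_pow_left₀ hx.1 hxy 2
    exact Real.exp_le_exp.2 (by nlinarith)
  have h1 := hanti.sum_le_integral
  have hint : MeasureTheory.IntegrableOn (fun x : ℝ => Real.exp (-(l / 2) * x ^ 2))
      (Set.Ioi 0) := (integrable_exp_neg_mul_sq (by positivity)).integrableOn
  have h2 : ∫ x in (0 : ℝ)..(0 + S), Real.exp (-(l / 2) * x ^ 2) ≤
      ∫ x in Set.Ioi (0 : ℝ), Real.exp (-(l / 2) * x ^ 2) := by
    rw [intervalIntegral.integral_of_le (by simp)]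
    exact MeasureTheory.setIntegral_mono_set hint
      (Filter.Eventually.of_forall fun x => (Real.exp_pos _).le)
      (Filter.Eventually.of_forall fun x hx => hx.1)
  rw [integral_gaussian_Ioi] at h2
  have h3 : √(Real.pi / (l / 2)) / 2 = √(Real.pi / (2 * l)) := by
    rw [show Real.pi / (l / 2) = 2 ^ 2 * (Real.pi / (2 * l)) by field_simp,
      Real.sqrt_mul (by positivity), Real.sqrt_sq (by norm_num)]
    ring
  rw [h3] at h2
  refine le_trans (Finset.sum_le_sum fun s _ => ?_) (h1.trans h2)
  rw [emptyProb_exp]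
  refine Real.exp_le_exp.2 ?_
  push_cast
  nlinarith [(Nat.cast_nonneg s : (0 : ℝ) ≤ s)]

/-- The quadratic decay of the exponent absorbs the crude factor `exp (s + 1)`; the sum is the
second-order constant of the moment bound. -/
lemma summable_emptyProb_mul {l : ℝ} (hl : 0 < l) :
    Summable fun s : ℕ =>
      emptyProb (Real.exp (-l)) s * (((s : ℝ) + 1) ^ 2 * Real.exp (s + 1)) := by
  -- From `l * s ≥ 8` on, the exponent is at most `-4 * (s + 1)`, more than enough to offset `s +
  -- 1`.
  obtain ⟨m, hm⟩ := exists_nat_gt ((2 : ℝ) / l * 4)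
  have hpoly : Summable fun s : ℕ => ((s : ℝ) + 1) ^ 2 * Real.exp (-((s : ℝ) + 1)) := by
    have h := Real.summable_pow_mul_exp_neg_nat_mul 2 (r := 1) one_pos
    have h' := (summable_nat_add_iff 1).2 h
    refine h'.congr fun s => ?_
    push_cast
    ring_nf
  refine hpoly.of_norm_bounded_eventually_nat ?_
  filter_upwards [Filter.eventually_ge_atTop m] with s hs
  have hms : (m : ℝ) ≤ s := by exact_mod_cast hs
  have hls : 8 ≤ l * s := by
    have : 8 < m * l := by
      have := (div_lt_iff₀ hl).1 (show 8 / l < m by calc 8 / l = 2 / l * 4 := by ring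
        _ < m := hm)
      exact this
    nlinarith
  rw [emptyProb_exp, Real.norm_of_nonneg (by positivity)]
  have : Real.exp (-l * (s * (s + 1) / 2)) * Real.exp (s + 1) ≤ Real.exp (-((s : ℝ) + 1)) := by
    rw [← Real.exp_add]
    refine Real.exp_le_exp.2 ?_
    nlinarith [(Nat.cast_nonneg s : (0 : ℝ) ≤ s)]
  calc _ = ((s : ℝ) + 1) ^ 2 * (Real.exp (-l * (s * (s + 1) / 2)) * Real.exp (s + 1)) := by ring
    _ ≤ _ := by gcongr

/-- The exponential moment of a greedy step, to first order. -/
lemma exists_moment_bound {l : ℝ} (hl : 0 < l) :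
    ∃ D : ℝ, 0 ≤ D ∧ ∀ η : ℝ, 0 ≤ η → η ≤ 1 → ∀ S,
      ∑ s ∈ Finset.range S, emptyProb (Real.exp (-l)) s * diagMoment (Real.exp (-l)) η s ≤
        1 + η * (1 + √(Real.pi / (2 * l)) / 2) + η ^ 2 * D := by
  set q := Real.exp (-l) with hq
  have h0 : 0 ≤ q := (Real.exp_pos _).le
  have h1 : q ≤ 1 := Real.exp_le_one_iff.2 (by linarith)
  have hsum := summable_emptyProb_mul hl
  rw [← hq] at hsum
  have hE := emptyProb_nonneg h0
  have hnn : ∀ s : ℕ, 0 ≤ emptyProb q s * (((s : ℝ) + 1) ^ 2 * Real.exp (s + 1)) := fun s =>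
    mul_nonneg (hE s) (by positivity)
  refine ⟨∑' s : ℕ, emptyProb q s * (((s : ℝ) + 1) ^ 2 * Real.exp (s + 1)), tsum_nonneg hnn, ?_⟩
  intro η hη hη1 S
  have hterm : ∀ s ∈ Finset.range S, emptyProb q s * diagMoment q η s ≤
      emptyProb q s * (1 - q ^ (s + 1)) +
        η * (emptyProb q s * (1 - q ^ (s + 1)) * (((s : ℝ) + 2) / 2)) +
        η ^ 2 * (emptyProb q s * (((s : ℝ) + 1) ^ 2 * Real.exp (s + 1))) := by
    intro s _
    have h := mul_le_mul_of_nonneg_left (diagMoment_le h0 h1 hη hη1 s) (hE s)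
    have hr : (1 - q ^ (s + 1)) * (η ^ 2 * (emptyProb q s * (((s : ℝ) + 1) ^ 2 * Real.exp (s + 1))))
        ≤ 1 * (η ^ 2 * (emptyProb q s * (((s : ℝ) + 1) ^ 2 * Real.exp (s + 1)))) :=
      mul_le_mul_of_nonneg_right (by linarith [pow_nonneg h0 (s + 1)])
        (mul_nonneg (by positivity) (hnn s))
    linarith
  refine (Finset.sum_le_sum hterm).trans ?_
  rw [Finset.sum_add_distrib, Finset.sum_add_distrib, ← Finset.mul_sum, ← Finset.mul_sum,
    sum_emptyProb_telescope, sum_emptyProb_mean]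
  have hD := hsum.sum_le_tsum (Finset.range S) fun s _ => hnn s
  have hg := sum_emptyProb_le hl S
  rw [← hq] at hg
  have hS : 0 ≤ ((S : ℝ) + 2) / 2 * emptyProb q S := mul_nonneg (by positivity) (hE S)
  have := hE S
  gcongr
  · linarith
  · linarith

/-! ### Poissonization -/

/-- The number of surjections from `Fin N` onto `T`. -/
def surjCount {α : Type*} [DecidableEq α] (N : ℕ) (T : Finset α) : ℕ :=
  ((Fintype.piFinset fun _ : Fin N => T).filter fun f => Finset.univ.image f = T).card

lemma sum_image_eq_sum_surjCount {α : Type*} [DecidableEq α] (N : ℕ) (U : Finset α)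
    (F : Finset α → ℝ) :
    ∑ f ∈ Fintype.piFinset (fun _ : Fin N => U), F (Finset.univ.image f) =
      ∑ T ∈ U.powerset, (surjCount N T : ℝ) * F T := by
  have hmaps : ∀ f ∈ Fintype.piFinset (fun _ : Fin N => U), Finset.univ.image f ∈ U.powerset := by
    intro f hf
    rw [Fintype.mem_piFinset] at hf
    rw [Finset.mem_powerset]
    intro x hx
    obtain ⟨i, _, rfl⟩ := Finset.mem_image.1 hx
    exact hf i
  rw [← Finset.sum_fiberwise_of_maps_to hmaps]
  refine Finset.sum_congr rfl fun T hT => ?_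
  have hfil : (Fintype.piFinset fun _ : Fin N => U).filter (fun f => Finset.univ.image f = T) =
      (Fintype.piFinset fun _ : Fin N => T).filter (fun f => Finset.univ.image f = T) := by
    ext f
    simp only [Finset.mem_filter, Fintype.mem_piFinset]
    refine ⟨fun h => ⟨fun i => ?_, h.2⟩, fun h => ⟨fun i => Finset.mem_powerset.1 hT (h.1 i), h.2⟩⟩
    rw [← h.2]
    exact Finset.mem_image_of_mem f (Finset.mem_univ i)
  rw [hfil, surjCount, ← nsmul_eq_mul, ← Finset.sum_const]
  refine Finset.sum_congr rfl fun f hf => ?_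
  rw [(Finset.mem_filter.1 hf).2]

lemma sum_surjCount {α : Type*} [DecidableEq α] (N : ℕ) (U : Finset α) :
    ∑ T ∈ U.powerset, (surjCount N T : ℝ) = (U.card : ℝ) ^ N := by
  have h := sum_image_eq_sum_surjCount N U fun _ => 1
  simp only [mul_one] at h
  rw [← h]
  simp [Fintype.card_piFinset]

/-- The exponential generating function of the number of surjections. -/
lemma hasSum_surjCount {α : Type*} [DecidableEq α] (l : ℝ) (U : Finset α) :
    HasSum (fun N : ℕ => l ^ N / N.factorial * surjCount N U)
      ((Real.exp l - 1) ^ U.card) := by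
  induction U using Finset.strongInduction with
  | H U ih =>
    -- All maps into `U` are classified by their image; removing those with proper image leaves the
    -- surjections, and the binomial theorem evaluates the difference.
    have hexp : HasSum (fun N : ℕ => (l * U.card) ^ N / N.factorial) (Real.exp (l * U.card)) := by
      rw [Real.exp_eq_exp_ℝ]
      exact NormedSpace.expSeries_div_hasSum_exp _
    have hss := hasSum_sum fun T (hT : T ∈ U.ssubsets) => ih T (Finset.mem_ssubsets.1 hT)
    have hsub := hexp.sub hss
    have hU : insert U U.ssubsets = U.powerset := by
      ext T
      simp only [Finset.mem_insert, Finset.mem_ssubsets, Finset.mem_powerset,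
        Finset.ssubset_iff_subset_ne]
      by_cases h : T = U
      · simp [h]
      · simp [h]
    have hnot : U ∉ U.ssubsets := fun h => (Finset.mem_ssubsets.1 h).2 (subset_refl U)
    have hterm : (fun N : ℕ => l ^ N / N.factorial * (surjCount N U : ℝ)) = fun N : ℕ =>
        (l * U.card) ^ N / N.factorial -
          ∑ T ∈ U.ssubsets, l ^ N / N.factorial * (surjCount N T : ℝ) := by
      funext N
      have h := sum_surjCount N U
      rw [← hU, Finset.sum_insert hnot] at h
      rw [← Finset.mul_sum, mul_pow, ← h]
      ring
    have hval : (Real.exp l - 1) ^ U.card = Real.exp (l * U.card) -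
        ∑ T ∈ U.ssubsets, (Real.exp l - 1) ^ T.card := by
      have h := Finset.sum_pow_mul_eq_add_pow (Real.exp l - 1) 1 U
      simp only [one_pow, mul_one] at h
      rw [← hU, Finset.sum_insert hnot] at h
      have he : Real.exp (l * U.card) = (Real.exp l - 1 + 1) ^ U.card := by
        rw [sub_add_cancel, ← Real.exp_nat_mul, mul_comm]
      rw [he, ← h]
      ring
    rw [hterm, hval]
    exact hsub

/-- Independent occupation of the elements of `U` is occupation by a Poisson number of independent
uniform points. -/
lemma hasSum_bernSum {α : Type*} [DecidableEq α] (l : ℝ) (U : Finset α) (F : Finset α → ℝ) :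
    HasSum (fun N : ℕ => Real.exp (-(l * U.card)) * (l ^ N / N.factorial) *
        ∑ f ∈ Fintype.piFinset (fun _ : Fin N => U), F (Finset.univ.image f))
      (bernSum (Real.exp (-l)) U F) := by
  have h := (hasSum_sum fun T (_ : T ∈ U.powerset) =>
    (hasSum_surjCount l T).mul_right (F T)).mul_left (Real.exp (-(l * U.card)))
  have hterm : (fun N : ℕ => Real.exp (-(l * U.card)) * (l ^ N / N.factorial) *
        ∑ f ∈ Fintype.piFinset (fun _ : Fin N => U), F (Finset.univ.image f)) = fun N : ℕ =>
      Real.exp (-(l * U.card)) *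
        ∑ T ∈ U.powerset, l ^ N / N.factorial * (surjCount N T : ℝ) * F T := by
    funext N
    rw [sum_image_eq_sum_surjCount, mul_assoc, Finset.mul_sum]
    congr 1
    exact Finset.sum_congr rfl fun T _ => by ring
  have hval : bernSum (Real.exp (-l)) U F = Real.exp (-(l * U.card)) *
      ∑ T ∈ U.powerset, (Real.exp l - 1) ^ T.card * F T := by
    rw [bernSum, Finset.mul_sum]
    refine Finset.sum_congr rfl fun T hT => ?_
    have hle := Finset.card_le_card (Finset.mem_powerset.1 hT)
    have h1 : 1 - Real.exp (-l) = Real.exp (-l) * (Real.exp l - 1) := by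
      rw [mul_sub, ← Real.exp_add]; simp
    have h2 : Real.exp (-(l * U.card)) = Real.exp (-l) ^ T.card *
        Real.exp (-l) ^ (U.card - T.card) := by
      rw [← pow_add, Nat.add_sub_cancel' hle, ← Real.exp_nat_mul]
      congr 1
      ring
    rw [h1, h2, mul_pow]
    ring
  rw [hterm, hval]
  exact h

/-- Forgetting the first point, which has `U.card` possible values, shrinks the image and so cannot
decrease `F`. -/
lemma sum_piFinset_succ_le {α : Type*} [DecidableEq α] (U : Finset α) {F : Finset α → ℝ}
    (hF : Antitone F) (N : ℕ) :
    ∑ f ∈ Fintype.piFinset (fun _ : Fin (N + 1) => U), F (Finset.univ.image f) ≤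
      U.card * ∑ f ∈ Fintype.piFinset (fun _ : Fin N => U), F (Finset.univ.image f) := by
  have h : ∑ f ∈ Fintype.piFinset (fun _ : Fin (N + 1) => U), F (Finset.univ.image f) =
      ∑ c ∈ U ×ˢ Fintype.piFinset (fun _ : Fin N => U),
        F (Finset.univ.image (Fin.cons c.1 c.2 : Fin (N + 1) → α)) := by
    symm
    refine Finset.sum_nbij' (fun c => (Fin.cons c.1 c.2 : Fin (N + 1) → α))
      (fun f => (f 0, Fin.tail f)) ?_ ?_ ?_ ?_ ?_
    · rintro ⟨c, f⟩ h
      simp only [Finset.mem_product, Fintype.mem_piFinset] at h ⊢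
      exact fun i => Fin.cases h.1 h.2 i
    · intro f h
      simp only [Finset.mem_product, Fintype.mem_piFinset] at h ⊢
      exact ⟨h 0, fun i => h i.succ⟩
    · rintro ⟨c, f⟩ _
      simp
    · intro f _
      simp
    · intro _ _
      rfl
  rw [h, Finset.sum_product, ← nsmul_eq_mul, ← Finset.sum_const]
  refine Finset.sum_le_sum fun c _ => Finset.sum_le_sum fun f _ => hF ?_
  intro x hx
  obtain ⟨i, _, rfl⟩ := Finset.mem_image.1 hx
  exact Finset.mem_image.2 ⟨i.succ, Finset.mem_univ _, by simp⟩

/-- Average of `F` over the sets of values of `N` independent uniform points of `U`. -/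
noncomputable def pointAvg {α : Type*} [DecidableEq α] (U : Finset α) (F : Finset α → ℝ) (N : ℕ) :
    ℝ :=
  (∑ f ∈ Fintype.piFinset (fun _ : Fin N => U), F (Finset.univ.image f)) / (U.card : ℝ) ^ N

lemma pointAvg_antitone {α : Type*} [DecidableEq α] {U : Finset α} (hU : U.Nonempty)
    {F : Finset α → ℝ} (hF : Antitone F) : Antitone (pointAvg U F) := by
  refine antitone_nat_of_succ_le fun N => ?_
  have hc : (0 : ℝ) < U.card := by exact_mod_cast hU.card_pos
  unfold pointAvg
  rw [pow_succ, div_le_div_iff₀ (by positivity) (by positivity)]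
  have := mul_le_mul_of_nonneg_right (sum_piFinset_succ_le U hF N) (pow_pos hc N).le
  linarith

lemma pointAvg_nonneg {α : Type*} [DecidableEq α] (U : Finset α) {F : Finset α → ℝ}
    (hF : ∀ T, 0 ≤ F T) (N : ℕ) : 0 ≤ pointAvg U F N :=
  div_nonneg (Finset.sum_nonneg fun _ _ => hF _) (by positivity)

/-- Markov's inequality for a Poisson variable of mean `a`, in the pointwise form that `1 - N / (n +
1)` is at most the indicator of `N ≤ n`. -/
lemma one_sub_div_le_sum_poisson {a : ℝ} (ha : 0 ≤ a) (n : ℕ) :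
    1 - a / (n + 1) ≤ ∑ N ∈ Finset.range (n + 1), Real.exp (-a) * (a ^ N / N.factorial) := by
  have hexp : HasSum (fun N : ℕ => Real.exp (-a) * (a ^ N / N.factorial)) 1 := by
    have h : HasSum (fun N : ℕ => a ^ N / N.factorial) (Real.exp a) := by
      rw [Real.exp_eq_exp_ℝ]
      exact NormedSpace.expSeries_div_hasSum_exp _
    have h := h.mul_left (Real.exp (-a))
    rwa [← Real.exp_add, neg_add_cancel, Real.exp_zero] at h
  have hmean : HasSum (fun N : ℕ => (N : ℝ) * (Real.exp (-a) * (a ^ N / N.factorial))) a := by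
    rw [← hasSum_nat_add_iff' 1]
    simp only [Finset.range_one, Finset.sum_singleton, Nat.cast_zero, zero_mul, sub_zero]
    have h := hexp.mul_left a
    rw [mul_one] at h
    have hterm : (fun N : ℕ => ((N + 1 : ℕ) : ℝ) *
        (Real.exp (-a) * (a ^ (N + 1) / (N + 1).factorial))) =
        fun N : ℕ => a * (Real.exp (-a) * (a ^ N / N.factorial)) := by
      funext N
      rw [Nat.factorial_succ, pow_succ]
      push_cast
      field_simp
    rw [hterm]
    exact h
  have hn : (0 : ℝ) < n + 1 := by positivity
  have hpos : ∀ N : ℕ, 0 ≤ Real.exp (-a) * (a ^ N / N.factorial) := fun N => by positivity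
  have hfin : HasSum (fun N : ℕ => if N < n + 1 then Real.exp (-a) * (a ^ N / N.factorial) else 0)
      (∑ N ∈ Finset.range (n + 1), Real.exp (-a) * (a ^ N / N.factorial)) := by
    have h : HasSum
        (fun N : ℕ => if N < n + 1 then Real.exp (-a) * (a ^ N / N.factorial) else 0) _ :=
      hasSum_sum_of_ne_finset_zero (s := Finset.range (n + 1))
        fun N hN => if_neg fun h => hN (Finset.mem_range.2 h)
    rwa [Finset.sum_congr rfl fun N hN => if_pos (Finset.mem_range.1 hN)] at h
  refine hasSum_le (fun N => ?_) (hexp.sub (hmean.div_const ((n : ℝ) + 1))) hfin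
  split_ifs with hN
  · have := div_nonneg (mul_nonneg (Nat.cast_nonneg N) (hpos N)) hn.le
    linarith
  · have hN' : (n : ℝ) + 1 ≤ N := by exact_mod_cast not_lt.1 hN
    rw [sub_nonpos, le_div_iff₀ hn, mul_comm]
    exact mul_le_mul_of_nonneg_right hN' (hpos N)

/-- With a Poisson number `N` of points, monotonicity lets `n` points replace `N` on the event `N ≤
n`, whose probability is bounded below by Markov. -/
lemma pointAvg_mul_le_bernSum {α : Type*} [DecidableEq α] {U : Finset α} (hU : U.Nonempty)
    {F : Finset α → ℝ} (hF : Antitone F) (hF0 : ∀ T, 0 ≤ F T) {l : ℝ} (hl : 0 ≤ l) (n : ℕ) :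
    pointAvg U F n * (1 - l * U.card / (n + 1)) ≤ bernSum (Real.exp (-l)) U F := by
  have hc : (0 : ℝ) < U.card := by exact_mod_cast hU.card_pos
  have hterm : ∀ N : ℕ, Real.exp (-(l * U.card)) * (l ^ N / N.factorial) *
        ∑ f ∈ Fintype.piFinset (fun _ : Fin N => U), F (Finset.univ.image f) =
      Real.exp (-(l * U.card)) * ((l * U.card) ^ N / N.factorial) * pointAvg U F N := by
    intro N
    unfold pointAvg
    rw [mul_pow]
    field_simp
  have hsum := hasSum_bernSum l U F
  simp only [hterm] at hsum
  have hpos : ∀ N : ℕ, 0 ≤ Real.exp (-(l * U.card)) * ((l * U.card) ^ N / N.factorial) :=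
    fun N => by positivity
  calc pointAvg U F n * (1 - l * U.card / (n + 1))
      ≤ pointAvg U F n * ∑ N ∈ Finset.range (n + 1),
          Real.exp (-(l * U.card)) * ((l * U.card) ^ N / N.factorial) :=
        mul_le_mul_of_nonneg_left (one_sub_div_le_sum_poisson (by positivity) n)
          (pointAvg_nonneg U hF0 n)
    _ ≤ ∑ N ∈ Finset.range (n + 1),
          Real.exp (-(l * U.card)) * ((l * U.card) ^ N / N.factorial) * pointAvg U F N := by
        rw [Finset.mul_sum]
        refine Finset.sum_le_sum fun N hN => ?_
        rw [mul_comm]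
        exact mul_le_mul_of_nonneg_left
          (pointAvg_antitone hU hF (Nat.lt_succ_iff.1 (Finset.mem_range.1 hN))) (hpos N)
    _ ≤ _ := sum_le_hasSum _ (fun N _ => mul_nonneg (hpos N) (pointAvg_nonneg U hF0 N)) hsum

/-! ### From chains of points to increasing subsequences -/

lemma card_le_lisLength {n : ℕ} (σ : Equiv.Perm (Fin n)) {s : Finset (Fin n)}
    (hs : ∀ i ∈ s, ∀ j ∈ s, i < j → σ i < σ j) : s.card ≤ lisLength σ :=
  Finset.le_sup (f := Finset.card) (Finset.mem_filter.2 ⟨Finset.mem_univ s, hs⟩)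

/-- Choosing one index for each chain cell suffices: distinct cells have distinct indices, and
several points in one cell do no harm. -/
lemma HasChain.exists_indices {n k : ℕ} {f : Fin n → ℕ × ℕ}
    (h : HasChain k (Finset.univ.image f)) :
    ∃ s : Finset (Fin n), s.card = k ∧ ∀ i ∈ s, ∀ j ∈ s, i ≠ j →
      ((f i).1 < (f j).1 ∧ (f i).2 < (f j).2) ∨ ((f j).1 < (f i).1 ∧ (f j).2 < (f i).2) := by
  obtain ⟨t, ht, hk, hc⟩ := h
  have hex : ∀ a ∈ t, ∃ i, f i = a := fun a ha => by
    obtain ⟨i, _, hi⟩ := Finset.mem_image.1 (ht ha)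
    exact ⟨i, hi⟩
  choose g hg using hex
  refine ⟨t.attach.image fun a : t => g a.1 a.2, ?_, ?_⟩
  · rw [Finset.card_image_of_injective, Finset.card_attach, hk]
    intro a b hab
    refine Subtype.ext ?_
    rw [← hg a.1 a.2, ← hg b.1 b.2]
    exact congrArg f hab
  · intro i hi j hj hij
    obtain ⟨a, _, rfl⟩ := Finset.mem_image.1 hi
    obtain ⟨b, _, rfl⟩ := Finset.mem_image.1 hj
    rw [hg a.1 a.2, hg b.1 b.2]
    exact hc a.1 a.2 b.1 b.2 fun h => hij (by rw [Subtype.ext h])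

/-- After sorting both coordinates, a chain of points becomes an increasing subsequence. -/
lemma HasChain.le_lisLength {n k : ℕ} (x y : Fin n → ℕ) (p : Equiv.Perm (Fin n))
    (h : HasChain k (Finset.univ.image fun i => (x i, y (p i)))) :
    k ≤ lisLength ((Tuple.sort y)⁻¹ * p * Tuple.sort x) := by
  obtain ⟨s, hk, hs⟩ := h.exists_indices
  set a := Tuple.sort x with ha
  set b := Tuple.sort y with hb
  have hx : Monotone (x ∘ a) := Tuple.monotone_sort x
  have hy : Monotone (y ∘ b) := Tuple.monotone_sort y
  have hcard : (s.map a.symm.toEmbedding).card = k := by rw [Finset.card_map, hk]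
  rw [← hcard]
  refine card_le_lisLength _ ?_
  intro i hi j hj hij
  obtain ⟨i', hi', rfl⟩ := Finset.mem_map.1 hi
  obtain ⟨j', hj', rfl⟩ := Finset.mem_map.1 hj
  simp only [Equiv.toEmbedding_apply] at hij
  have hxij : x i' ≤ x j' := by simpa using hx hij.le
  rcases hs i' hi' j' hj' (by rintro rfl; exact lt_irrefl _ hij) with h | h
  · simp only [Equiv.toEmbedding_apply, Equiv.Perm.mul_apply, Equiv.apply_symm_apply]
    by_contra hcon
    have := hy (not_lt.1 hcon)
    simp only [Function.comp, Equiv.Perm.inv_def, Equiv.apply_symm_apply] at this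
    exact absurd h.2 (not_lt.2 this)
  · exact absurd h.1 (not_lt.2 hxij)

lemma sum_lisLength (n : ℕ) :
    ∑ σ : Equiv.Perm (Fin n), (lisLength σ : ℝ) = n.factorial * expectedLIS n := by
  have : (n.factorial : ℝ) ≠ 0 := by exact_mod_cast n.factorial_ne_zero
  unfold expectedLIS
  field_simp

lemma mul_one_sub_noChain_le_lisLength {n k : ℕ} (x y : Fin n → ℕ) (p : Equiv.Perm (Fin n)) :
    (k : ℝ) * (1 - noChain k (Finset.univ.image fun i => (x i, y (p i)))) ≤
      lisLength ((Tuple.sort y)⁻¹ * p * Tuple.sort x) := by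
  unfold noChain
  split_ifs with h
  · rw [sub_zero, mul_one]
    exact_mod_cast h.le_lisLength x y p
  · simp

/-- Symmetrization over the second coordinates compares independent points of a grid with a uniform
permutation. -/
lemma mul_one_sub_pointAvg_le_expectedLIS {K : ℕ} (hK : 0 < K) (n k : ℕ) :
    (k : ℝ) * (1 - pointAvg (Finset.range K ×ˢ Finset.range K) (noChain k) n) ≤
      expectedLIS n := by
  set U := Finset.range K ×ˢ Finset.range K with hU
  set Ω := Fintype.piFinset fun _ : Fin n => U with hΩ
  have hcard : (0 : ℝ) < U.card := by
    have : 0 < U.card := by rw [hU, Finset.card_product, Finset.card_range]; positivity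
    exact_mod_cast this
  have hΩcard : (Ω.card : ℝ) = (U.card : ℝ) ^ n := by simp [hΩ, Fintype.card_piFinset]
  set φ : (Fin n → ℕ × ℕ) → ℝ := fun f => (k : ℝ) * (1 - noChain k (Finset.univ.image f)) with hφ
  have hperm : ∀ p : Equiv.Perm (Fin n),
      ∑ f ∈ Ω, φ (fun i => ((f i).1, (f (p i)).2)) = ∑ f ∈ Ω, φ f := by
    intro p
    refine Finset.sum_nbij' (fun f i => ((f i).1, (f (p i)).2))
      (fun f i => ((f i).1, (f (p.symm i)).2)) ?_ ?_ ?_ ?_ ?_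
    · intro f hf
      simp only [hΩ, hU, Fintype.mem_piFinset, Finset.mem_product] at hf ⊢
      exact fun i => ⟨(hf i).1, (hf (p i)).2⟩
    · intro f hf
      simp only [hΩ, hU, Fintype.mem_piFinset, Finset.mem_product] at hf ⊢
      exact fun i => ⟨(hf i).1, (hf (p.symm i)).2⟩
    · intro f _
      simp
    · intro f _
      simp
    · intro f _
      rfl
  have hle : ∀ f : Fin n → ℕ × ℕ,
      ∑ p : Equiv.Perm (Fin n), φ (fun i => ((f i).1, (f (p i)).2)) ≤
        n.factorial * expectedLIS n := by
    intro f
    -- For fixed `f`, multiplication by the two sorting permutations is a bijection, so each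
    -- permutation arises from exactly one `p`, even when coordinates tie.
    rw [← sum_lisLength, ← Equiv.sum_comp ((Equiv.mulLeft (Tuple.sort fun i => (f i).2)⁻¹).trans
      (Equiv.mulRight (Tuple.sort fun i => (f i).1))) fun σ => (lisLength σ : ℝ)]
    exact Finset.sum_le_sum fun p _ =>
      mul_one_sub_noChain_le_lisLength (fun i => (f i).1) (fun i => (f i).2) p
  have htot : (n.factorial : ℝ) * ∑ f ∈ Ω, φ f ≤
      (U.card : ℝ) ^ n * (n.factorial * expectedLIS n) := by
    calc (n.factorial : ℝ) * ∑ f ∈ Ω, φ f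
        = ∑ p : Equiv.Perm (Fin n), ∑ f ∈ Ω, φ (fun i => ((f i).1, (f (p i)).2)) := by
          simp only [hperm]
          rw [Finset.sum_const, Finset.card_univ, Fintype.card_perm, Fintype.card_fin,
            nsmul_eq_mul]
      _ = ∑ f ∈ Ω, ∑ p : Equiv.Perm (Fin n), φ (fun i => ((f i).1, (f (p i)).2)) :=
          Finset.sum_comm
      _ ≤ ∑ f ∈ Ω, n.factorial * expectedLIS n := Finset.sum_le_sum fun f _ => hle f
      _ = _ := by rw [Finset.sum_const, nsmul_eq_mul, hΩcard]
  have hn : (0 : ℝ) < n.factorial := by exact_mod_cast n.factorial_pos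
  have hφsum : ∑ f ∈ Ω, φ f = (U.card : ℝ) ^ n * ((k : ℝ) * (1 - pointAvg U (noChain k) n)) := by
    simp only [hφ]
    rw [← Finset.mul_sum, Finset.sum_sub_distrib, Finset.sum_const, nsmul_eq_mul, hΩcard, pointAvg,
      ← hΩ]
    field_simp
  rw [hφsum] at htot
  have hpos : 0 < (n.factorial : ℝ) * (U.card : ℝ) ^ n := by positivity
  refine le_of_mul_le_mul_left ?_ hpos
  linarith

/-! ### The upper bound by first moments -/

lemma eq_one_of_strictMono_perm {n : ℕ} {s : Finset (Fin n)} (τ : Equiv.Perm s)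
    (h : StrictMono τ) : τ = 1 := by
  have h' : (⟨τ, h.le_iff_le⟩ : s ≃o s) = OrderIso.refl s := Subsingleton.elim _ _
  ext i
  have := congrArg (fun e : s ≃o s => e i) h'
  exact congrArg (fun j : s => (j : ℕ)) this

/-- At most a fraction `1 / |s|!` of all permutations is increasing on `s`. -/
lemma card_increasing_mul_factorial_le {n : ℕ} (s : Finset (Fin n)) :
    (Finset.univ.filter fun σ : Equiv.Perm (Fin n) =>
      ∀ i ∈ s, ∀ j ∈ s, i < j → σ i < σ j).card * s.card.factorial ≤ n.factorial := by
  set A := Finset.univ.filter fun σ : Equiv.Perm (Fin n) => ∀ i ∈ s, ∀ j ∈ s, i < j → σ i < σ j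
  have hcard : (A ×ˢ (Finset.univ : Finset (Equiv.Perm s))).card =
      A.card * s.card.factorial := by
    rw [Finset.card_product, Finset.card_univ, Fintype.card_perm, Fintype.card_coe]
  have hn : n.factorial = (Finset.univ : Finset (Equiv.Perm (Fin n))).card := by
    rw [Finset.card_univ, Fintype.card_perm, Fintype.card_fin]
  rw [← hcard, hn]
  refine Finset.card_le_card_of_injOn (fun z => z.1 * Equiv.Perm.ofSubtype z.2)
    (fun _ _ => Finset.mem_univ _) ?_
  rintro ⟨σ, τ⟩ h ⟨σ', τ'⟩ h' heq
  have hσ := (Finset.mem_filter.1 (Finset.mem_product.1 h).1).2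
  have hσ' := (Finset.mem_filter.1 (Finset.mem_product.1 h').1).2
  simp only at heq hσ hσ'
  -- Two permutations increasing on `s` that differ by a rearrangement of `s` force that
  -- rearrangement to be order preserving, hence trivial.
  have hσeq : σ = σ' * Equiv.Perm.ofSubtype (τ' * τ⁻¹) := by
    rw [map_mul, map_inv, ← mul_assoc, ← heq, mul_assoc, mul_inv_cancel, mul_one]
  have hmono : StrictMono (τ' * τ⁻¹) := by
    intro i j hij
    have h1 := hσ i i.2 j j.2 hij
    rw [hσeq] at h1
    simp only [Equiv.Perm.mul_apply, Equiv.Perm.ofSubtype_apply_coe] at h1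
    by_contra hcon
    rcases (not_lt.1 hcon).lt_or_eq with h2 | h2
    · exact absurd h1 (hσ' _ (Subtype.coe_prop _) _ (Subtype.coe_prop _) h2).asymm
    · exact hij.ne ((τ' * τ⁻¹).injective h2.symm)
  have hone := eq_one_of_strictMono_perm _ hmono
  rw [hone, map_one, mul_one] at hσeq
  rw [mul_inv_eq_one] at hone
  rw [hσeq, hone]

lemma exists_increasing_of_le_lisLength {n k : ℕ} {σ : Equiv.Perm (Fin n)}
    (h : k ≤ lisLength σ) :
    ∃ s ∈ Finset.powersetCard k (Finset.univ : Finset (Fin n)),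
      ∀ i ∈ s, ∀ j ∈ s, i < j → σ i < σ j := by
  have hne : (Finset.univ.filter fun s : Finset (Fin n) =>
      ∀ i ∈ s, ∀ j ∈ s, i < j → σ i < σ j).Nonempty :=
    ⟨∅, by simp⟩
  obtain ⟨t, ht, hcard⟩ := Finset.exists_mem_eq_sup _ hne Finset.card
  have hk : k ≤ t.card := by rw [← hcard]; exact h
  obtain ⟨s, hst, hs⟩ := Finset.exists_subset_card_eq hk
  exact ⟨s, Finset.mem_powersetCard.2 ⟨Finset.subset_univ s, hs⟩, fun i hi j hj =>
    (Finset.mem_filter.1 ht).2 i (hst hi) j (hst hj)⟩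

lemma card_le_lisLength_mul_factorial_le (n k : ℕ) :
    (Finset.univ.filter fun σ : Equiv.Perm (Fin n) => k ≤ lisLength σ).card * k.factorial ≤
      n.choose k * n.factorial := by
  have hsub : (Finset.univ.filter fun σ : Equiv.Perm (Fin n) => k ≤ lisLength σ) ⊆
      (Finset.powersetCard k (Finset.univ : Finset (Fin n))).biUnion fun s =>
        Finset.univ.filter fun σ : Equiv.Perm (Fin n) => ∀ i ∈ s, ∀ j ∈ s, i < j → σ i < σ j := by
    intro σ hσ
    obtain ⟨s, hs, h⟩ := exists_increasing_of_le_lisLength (Finset.mem_filter.1 hσ).2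
    exact Finset.mem_biUnion.2 ⟨s, hs, Finset.mem_filter.2 ⟨Finset.mem_univ σ, h⟩⟩
  refine (Nat.mul_le_mul_right _ ((Finset.card_le_card hsub).trans Finset.card_biUnion_le)).trans ?_
  rw [Finset.sum_mul]
  refine (Finset.sum_le_card_nsmul _ _ n.factorial fun s hs => ?_).trans_eq ?_
  · rw [← (Finset.mem_powersetCard.1 hs).2]
    exact card_increasing_mul_factorial_le s
  · rw [Finset.card_powersetCard, Finset.card_univ, Fintype.card_fin, smul_eq_mul]

lemma lisLength_le {n : ℕ} (σ : Equiv.Perm (Fin n)) : lisLength σ ≤ n :=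
  Finset.sup_le fun s _ => (Finset.card_le_univ s).trans_eq (Fintype.card_fin n)

lemma expectedLIS_le (n k : ℕ) :
    expectedLIS n ≤ k + n * ((n : ℝ) ^ k / (k.factorial : ℝ) ^ 2) := by
  have hn : (0 : ℝ) < n.factorial := by exact_mod_cast n.factorial_pos
  have hk : (0 : ℝ) < k.factorial := by exact_mod_cast k.factorial_pos
  set A := Finset.univ.filter fun σ : Equiv.Perm (Fin n) => k ≤ lisLength σ with hA
  have hterm : ∀ σ : Equiv.Perm (Fin n),
      (lisLength σ : ℝ) ≤ k + n * (if k ≤ lisLength σ then 1 else 0) := by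
    intro σ
    split_ifs with h
    · have : (lisLength σ : ℝ) ≤ n := by exact_mod_cast lisLength_le σ
      linarith [(Nat.cast_nonneg k : (0 : ℝ) ≤ k)]
    · have : (lisLength σ : ℝ) ≤ k := by exact_mod_cast (not_le.1 h).le
      linarith
  have hsum : (n.factorial : ℝ) * expectedLIS n ≤ n.factorial * k + n * A.card := by
    rw [← sum_lisLength]
    refine (Finset.sum_le_sum fun σ _ => hterm σ).trans_eq ?_
    rw [Finset.sum_add_distrib, ← Finset.mul_sum, Finset.sum_boole, Finset.sum_const,
      Finset.card_univ, Fintype.card_perm, Fintype.card_fin, nsmul_eq_mul]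
  have hcount : (A.card : ℝ) * k.factorial ≤ n.choose k * n.factorial := by
    exact_mod_cast card_le_lisLength_mul_factorial_le n k
  have hchoose : (n.choose k : ℝ) ≤ (n : ℝ) ^ k / k.factorial := Nat.choose_le_pow_div k n
  have hAcard : (A.card : ℝ) ≤ n.factorial * ((n : ℝ) ^ k / (k.factorial : ℝ) ^ 2) := by
    calc (A.card : ℝ) ≤ n.choose k * n.factorial / k.factorial := (le_div_iff₀ hk).2 hcount
      _ ≤ (n : ℝ) ^ k / k.factorial * n.factorial / k.factorial := by gcongr
      _ = _ := by field_simp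
  refine le_of_mul_le_mul_left (hsum.trans ?_) hn
  have := mul_le_mul_of_nonneg_left hAcard (Nat.cast_nonneg n : (0 : ℝ) ≤ n)
  linarith

/-- Combine `n ≤ (k / a) ^ 2` with `k ^ k / k! ≤ exp k`. -/
lemma pow_div_factorial_sq_le {a : ℝ} (ha : 0 < a) {n k : ℕ} (hk : a * √n ≤ k) :
    (n : ℝ) ^ k / (k.factorial : ℝ) ^ 2 ≤ ((Real.exp 1 / a) ^ 2) ^ k := by
  have hkf : (0 : ℝ) < k.factorial := by exact_mod_cast k.factorial_pos
  have h1 : √n ≤ k / a := by rw [le_div_iff₀ ha]; linarith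
  have h2 : (n : ℝ) ≤ (k / a) ^ 2 := by
    rw [← Real.sq_sqrt (Nat.cast_nonneg n : (0 : ℝ) ≤ n)]
    gcongr
  have h3 : (k : ℝ) ^ k / k.factorial ≤ Real.exp 1 ^ k := by
    rw [← Real.exp_nat_mul, mul_one]
    exact Real.pow_div_factorial_le_exp (k : ℝ) (Nat.cast_nonneg k) k
  calc (n : ℝ) ^ k / (k.factorial : ℝ) ^ 2 ≤ ((k / a) ^ 2) ^ k / (k.factorial : ℝ) ^ 2 := by
        gcongr
    _ = ((k : ℝ) ^ k / k.factorial) ^ 2 / (a ^ k) ^ 2 := by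
        rw [div_pow, div_pow, div_pow, ← pow_mul, ← pow_mul, ← pow_mul, ← pow_mul, mul_comm 2 k]
        field_simp
    _ ≤ (Real.exp 1 ^ k) ^ 2 / (a ^ k) ^ 2 := by gcongr
    _ = _ := by
        rw [div_pow, div_pow, ← pow_mul, ← pow_mul, ← pow_mul, ← pow_mul, mul_comm 2 k]

lemma exists_expectedLIS_le {a : ℝ} (ha : Real.exp 1 < a) :
    ∃ C : ℝ, ∀ n : ℕ, expectedLIS n ≤ a * √n + C := by
  have ha0 : 0 < a := (Real.exp_pos 1).trans ha
  have ha1 : 1 ≤ a := (Real.one_le_exp zero_le_one).trans ha.le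
  have hρ : (Real.exp 1 / a) ^ 2 < 1 :=
    pow_lt_one₀ (by positivity) ((div_lt_one ha0).2 ha) two_ne_zero
  -- The factor `n` from `L ≤ n` is at most `k ^ 2`, so a bound for `k ^ 2 * ρ ^ k` uniform in `k`
  -- controls the tail term.
  have hlim := tendsto_pow_const_mul_const_pow_of_lt_one 2 (sq_nonneg (Real.exp 1 / a)) hρ
  obtain ⟨B, hB⟩ := hlim.bddAbove_range
  refine ⟨1 + B, fun n => ?_⟩
  set k := ⌈a * √n⌉₊ with hk
  have hak : a * √n ≤ k := Nat.le_ceil _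
  have hka : (k : ℝ) ≤ a * √n + 1 := (Nat.ceil_lt_add_one (by positivity)).le
  have hnk : (n : ℝ) ≤ (k : ℝ) ^ 2 := by
    have : √n ≤ k := (le_mul_of_one_le_left (Real.sqrt_nonneg _) ha1).trans hak
    rw [← Real.sq_sqrt (Nat.cast_nonneg n : (0 : ℝ) ≤ n)]
    gcongr
  have hB' : (k : ℝ) ^ 2 * ((Real.exp 1 / a) ^ 2) ^ k ≤ B := hB ⟨k, rfl⟩
  calc expectedLIS n ≤ k + n * ((n : ℝ) ^ k / (k.factorial : ℝ) ^ 2) := expectedLIS_le n k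
    _ ≤ k + (k : ℝ) ^ 2 * ((Real.exp 1 / a) ^ 2) ^ k := by
        have := pow_div_factorial_sq_le ha0 hak
        gcongr
    _ ≤ a * √n + (1 + B) := by linarith

lemma tendsto_const_div_sqrt_nat (C : ℝ) :
    Filter.Tendsto (fun n : ℕ => C / √(n : ℝ)) Filter.atTop (nhds 0) :=
  Filter.Tendsto.const_div_atTop (Real.tendsto_sqrt_atTop.comp tendsto_natCast_atTop_atTop) C

lemma eventually_expectedLIS_div_le {b : ℝ} (hb : Real.exp 1 < b) :
    ∀ᶠ n : ℕ in Filter.atTop, expectedLIS n / √(n : ℝ) ≤ b := by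
  obtain ⟨a, ha, hab⟩ := exists_between hb
  obtain ⟨C, hC⟩ := exists_expectedLIS_le ha
  have hlim := (tendsto_const_div_sqrt_nat C).eventually_le_const (sub_pos.2 hab)
  filter_upwards [hlim, Filter.eventually_gt_atTop 0] with n hn hn0
  have hs : 0 < √(n : ℝ) := Real.sqrt_pos.2 (by exact_mod_cast hn0)
  have h1 : expectedLIS n / √(n : ℝ) ≤ (a * √n + C) / √(n : ℝ) := by
    have := hC n
    gcongr
  rw [add_div, mul_div_cancel_right₀ _ hs.ne'] at h1
  linarith

/-! ### The lower bound -/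

lemma cornerBox_zero (K : ℕ) : cornerBox K 0 0 0 = Finset.range K ×ˢ Finset.range K := by
  ext d
  simp [mem_cornerBox]

/-- A linear drift bound for the greedy search yields a linear lower bound for the mean, uniformly in
the number of points. -/
lemma exists_le_expectedLIS {l η m κ r : ℝ} (hl : 0 < l) (hη : 0 < η) (hm : 0 < m)
    (hmoment : ∀ S, ∑ s ∈ Finset.range S,
      emptyProb (Real.exp (-l)) s * diagMoment (Real.exp (-l)) η s ≤ 1 + η * m)
    (hκ : 0 < κ) (hκm : κ * m < 1) (hr : 0 < r) (hlr : l * r ^ 2 < 1) :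
    ∃ C : ℝ, ∀ n : ℕ, 1 ≤ r * √n → κ * r * √n - C ≤ expectedLIS n := by
  -- `c` is the exponential rate of failure for chains of length `κ * K`; `ε` bounds from below the
  -- probability that the Poisson number is at most `n`.
  set c := η * (1 - κ * m) with hc
  set ε := 1 - l * r ^ 2 with hε
  have hc0 : 0 < c := mul_pos hη (by linarith)
  have hε0 : 0 < ε := by linarith
  -- `κ` and `1` pay for rounding down `K` and `k`; the last term bounds `k` times the failure
  -- probability `u`.
  refine ⟨κ + 1 + κ * (2 / (ε * c)), fun n hn => ?_⟩
  set K := ⌊r * √n⌋₊ with hK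
  set k := ⌊κ * K⌋₊ with hk
  set U := Finset.range K ×ˢ Finset.range K with hU
  have hK0 : 0 < K := Nat.floor_pos.2 hn
  have hKle : (K : ℝ) ≤ r * √n := Nat.floor_le (by positivity)
  have hKge : r * √n - 1 ≤ K := (Nat.sub_one_lt_floor _).le
  have hkle : (k : ℝ) ≤ κ * K := Nat.floor_le (by positivity)
  have hkge : κ * K - 1 ≤ k := (Nat.sub_one_lt_floor _).le
  have hUcard : (U.card : ℝ) = (K : ℝ) ^ 2 := by simp [hU, sq]
  have hUne : U.Nonempty := by
    rw [← Finset.card_pos, hU, Finset.card_product, Finset.card_range]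
    positivity
  have hfail : bernSum (Real.exp (-l)) U (noChain k) ≤ 2 * Real.exp (-(c * K)) := by
    have h := bernSum_noChain_le (Real.exp_pos (-l)).le (Real.exp_lt_one_iff.2 (by linarith)) hη.le
      (by nlinarith : 1 ≤ 1 + η * m) hmoment K k 0 0
    rw [cornerBox_zero] at h
    have hθ : (1 + η * m) ^ k ≤ Real.exp (k * (η * m)) := by
      rw [Real.exp_nat_mul]
      refine pow_le_pow_left₀ (by positivity) ?_ k
      linarith [Real.add_one_le_exp (η * m)]
    have hpot : cornerPotential η K 0 0 = 2 * Real.exp (-(η * K)) := by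
      unfold cornerPotential
      push_cast
      rw [zero_sub, mul_neg]
      ring
    calc _ ≤ (1 + η * m) ^ k * cornerPotential η K 0 0 := h
      _ ≤ Real.exp (k * (η * m)) * (2 * Real.exp (-(η * K))) := by
          rw [hpot]
          gcongr
      _ = 2 * Real.exp (k * (η * m) - η * K) := by
          rw [sub_eq_add_neg, Real.exp_add]
          ring
      _ ≤ _ := by
          have hle := mul_le_mul_of_nonneg_right hkle (mul_pos hη hm).le
          have : (k : ℝ) * (η * m) - η * K ≤ -(c * K) := by rw [hc]; linarith
          gcongr
  set u := pointAvg U (noChain k) n with hu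
  have hu0 : 0 ≤ u := pointAvg_nonneg U (noChain_nonneg k) n
  have hεle : ε ≤ 1 - l * U.card / (n + 1) := by
    have hn0 : (0 : ℝ) < n + 1 := by positivity
    have hK2 : (K : ℝ) ^ 2 ≤ r ^ 2 * n := by
      calc (K : ℝ) ^ 2 ≤ (r * √n) ^ 2 := by gcongr
        _ = r ^ 2 * n := by rw [mul_pow, Real.sq_sqrt (Nat.cast_nonneg n)]
    have : l * U.card / (n + 1) ≤ l * r ^ 2 := by
      rw [div_le_iff₀ hn0, hUcard]
      have := mul_le_mul_of_nonneg_left hK2 hl.le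
      have : 0 ≤ l * r ^ 2 := by positivity
      linarith
    linarith
  have hbern := pointAvg_mul_le_bernSum hUne (noChain_antitone k) (noChain_nonneg k) hl.le n
  rw [← hu] at hbern
  have huε : u * ε ≤ 2 * Real.exp (-(c * K)) :=
    (mul_le_mul_of_nonneg_left hεle hu0).trans (hbern.trans hfail)
  have hKexp : K * Real.exp (-(c * K)) ≤ 1 / c := by
    rw [Real.exp_neg, ← div_eq_mul_inv, div_le_div_iff₀ (Real.exp_pos _) hc0]
    linarith [Real.add_one_le_exp (c * K)]
  have hku : k * u ≤ κ * (2 / (ε * c)) := by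
    have hKu : K * u ≤ 2 / (ε * c) := by
      calc K * u = K * (u * ε) / ε := by field_simp
        _ ≤ K * (2 * Real.exp (-(c * K))) / ε := by gcongr
        _ = 2 * (K * Real.exp (-(c * K))) / ε := by ring
        _ ≤ 2 * (1 / c) / ε := by gcongr
        _ = _ := by field_simp
    calc k * u ≤ κ * K * u := by gcongr
      _ = κ * (K * u) := by ring
      _ ≤ _ := by gcongr
  have hmain := mul_one_sub_pointAvg_le_expectedLIS hK0 n k
  rw [← hU, ← hu] at hmain
  have hκK := mul_le_mul_of_nonneg_left hKge hκ.le
  linarith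

/-- As `√l → 0` the scaled mean `√l * (1 + √(π / (2 l)) / 2)` tends to `√(π / 8) ≈ 0.6267`, below `2
/ π ≈ 0.6366`. The value `√l = 0.009` is small enough to fit in the gap. -/
lemma drift_constant_lt :
    0.009 * (1 + √(Real.pi / (2 * 0.009 ^ 2)) / 2) < 2 / Real.pi := by
  have hπ := Real.pi_pos
  have hs : √(Real.pi / (2 * 0.009 ^ 2)) ≤ 1.2534 / 0.009 := by
    rw [Real.sqrt_le_left (by norm_num), div_pow, div_le_div_iff₀ (by norm_num) (by norm_num)]
    nlinarith [Real.pi_lt_d6]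
  rw [lt_div_iff₀ hπ]
  have h1 : 0.009 * (1 + √(Real.pi / (2 * 0.009 ^ 2)) / 2) ≤ 0.6357 := by
    have := mul_le_mul_of_nonneg_left hs (by norm_num : (0 : ℝ) ≤ 0.009)
    norm_num at this ⊢
    linarith
  have := mul_le_mul_of_nonneg_right h1 hπ.le
  linarith [Real.pi_lt_d6]

lemma exists_slope_gt_pi_div_two :
    ∃ b > Real.pi / 2, ∃ C : ℝ, ∀ᶠ n : ℕ in Filter.atTop, b * √n - C ≤ expectedLIS n := by
  have hπ := Real.pi_pos
  obtain ⟨D, hD0, hD⟩ := exists_moment_bound (l := 0.009 ^ 2) (by norm_num)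
  set μ : ℝ := 1 + √(Real.pi / (2 * 0.009 ^ 2)) / 2 with hμ
  have hμ0 : 0 < μ := by positivity
  have hgap : 0 < 2 / Real.pi - 0.009 * μ := sub_pos.2 drift_constant_lt
  -- The second-order term costs `0.009 * η * D`, so taking `η` at most the gap divided by `D + 1`
  -- leaves a strict inequality.
  obtain ⟨η, hη0, hη⟩ : ∃ η > 0, η ≤ 1 ∧ 0.009 * (μ + η * D) < 2 / Real.pi := by
    refine ⟨min 1 ((2 / Real.pi - 0.009 * μ) / (D + 1)), by positivity, min_le_left _ _, ?_⟩
    have h1 : min 1 ((2 / Real.pi - 0.009 * μ) / (D + 1)) * (D + 1) ≤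
        2 / Real.pi - 0.009 * μ := by
      rw [← le_div_iff₀ (by positivity)]
      exact min_le_right _ _
    have h2 : 0 < min 1 ((2 / Real.pi - 0.009 * μ) / (D + 1)) := by positivity
    nlinarith
  obtain ⟨hη1, hdrift⟩ := hη
  set m := μ + η * D with hm
  have hm0 : 0 < m := by positivity
  have hslope : Real.pi / 2 * 0.009 < 1 / m := by
    rw [lt_div_iff₀ hm0]
    rw [lt_div_iff₀ hπ] at hdrift
    linarith
  obtain ⟨κ, hκ1, hκ2⟩ := exists_between hslope
  have hκ0 : 0 < κ := lt_trans (by positivity) hκ1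
  -- The slope `κ * r` must exceed `π / 2` while `r < 1 / √l` keeps the Poisson mean below `n`; the
  -- strict choice of `κ` makes both possible.
  have hr : Real.pi / 2 / κ < 1 / 0.009 := by
    rw [div_lt_div_iff₀ hκ0 (by norm_num)]
    linarith
  obtain ⟨r, hr1, hr2⟩ := exists_between hr
  have hr0 : 0 < r := lt_trans (by positivity) hr1
  have hlr : (0.009 : ℝ) ^ 2 * r ^ 2 < 1 := by
    rw [← mul_pow]
    rw [lt_div_iff₀ (by norm_num)] at hr2
    exact pow_lt_one₀ (by positivity) (by linarith) two_ne_zero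
  obtain ⟨C, hC⟩ := exists_le_expectedLIS (l := 0.009 ^ 2) (by norm_num) hη0 hm0
    (fun S => (hD η hη0.le hη1 S).trans_eq (by rw [hm]; ring)) hκ0
    ((lt_div_iff₀ hm0).1 hκ2) hr0 hlr
  refine ⟨κ * r, ?_, C, ?_⟩
  · rw [div_lt_iff₀ hκ0] at hr1
    linarith
  · have hlim : Filter.Tendsto (fun n : ℕ => r * √(n : ℝ)) Filter.atTop Filter.atTop :=
      (Real.tendsto_sqrt_atTop.comp tendsto_natCast_atTop_atTop).const_mul_atTop hr0
    filter_upwards [hlim.eventually_ge_atTop 1] with n hn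
    exact hC n hn

lemma eventually_pi_div_two_le :
    ∀ᶠ n : ℕ in Filter.atTop, Real.pi / 2 ≤ expectedLIS n / √(n : ℝ) := by
  obtain ⟨b, hb, C, hC⟩ := exists_slope_gt_pi_div_two
  have hlim := (tendsto_const_div_sqrt_nat C).eventually_le_const (sub_pos.2 hb)
  filter_upwards [hlim, hC, Filter.eventually_gt_atTop 0] with n hn hn' hn0
  have hs : 0 < √(n : ℝ) := Real.sqrt_pos.2 (by exact_mod_cast hn0)
  have h1 : (b * √n - C) / √(n : ℝ) ≤ expectedLIS n / √(n : ℝ) := by gcongr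
  rw [sub_div, mul_div_cancel_right₀ _ hs.ne'] at h1
  linarith

theorem mainTheorem7 :
    ((Real.pi / 2 : ℝ) : EReal) ≤
        Filter.liminf (fun n : ℕ => ((expectedLIS n / Real.sqrt (n : ℝ) : ℝ) : EReal))
          Filter.atTop ∧
      Filter.liminf (fun n : ℕ => ((expectedLIS n / Real.sqrt (n : ℝ) : ℝ) : EReal))
          Filter.atTop ≤
        Filter.limsup (fun n : ℕ => ((expectedLIS n / Real.sqrt (n : ℝ) : ℝ) : EReal))
          Filter.atTop ∧
      Filter.limsup (fun n : ℕ => ((expectedLIS n / Real.sqrt (n : ℝ) : ℝ) : EReal))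
          Filter.atTop ≤ ((Real.exp 1 : ℝ) : EReal) := by
  refine ⟨?_, Filter.liminf_le_limsup, ?_⟩
  · refine Filter.le_liminf_of_le (h := ?_)
    filter_upwards [eventually_pi_div_two_le] with n hn
    exact EReal.coe_le_coe_iff.2 hn
  -- The first moment bound gives each real `b > e` but not `e` itself, so the endpoint is reached
  -- by approximation.
  · refine EReal.le_of_forall_lt_iff_le.1 fun b hb => ?_
    refine Filter.limsup_le_of_le (h := ?_)
    filter_upwards [eventually_expectedLIS_div_le (EReal.coe_lt_coe_iff.1 hb)] with n hn
    exact EReal.coe_le_coe_iff.2 hn
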